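/- Let $\mathbb{F}_q$ be a finite field and let $\mathcal{C}\subseteq\mathbb{F}_q^N$ be an $\mathbb{F}_q$-linear code of length $N\ge 1$ and dimension $K$; its rate is $K/N$. A uniformly random codeword $X=(X_1,\dots,X_N)$ of $\mathcal{C}$ is sent over the memoryless $q$-ary erasure channel, which erases each symbol independently with probability $p$ and otherwise delivers it correctly; $Y$ is the received word. The symbol-MAP decoder for position $i$ returns $X_i$ if $X_i$ is uniquely determined by $Y$ and an erasure otherwise; $P_{b,i}(p)$ is the probability that its output differs from $X_i$, and $P_b(p)=\frac1N\sum_i P_{b,i}(p)$. The average EXIT function is $h(p)=\frac1N\sum_i H(X_i\mid Y_{\sim i})$, where $Y_{\sim i}$ is $Y$ without its $i$-th entry and entropy is taken to base $q$; put $p_t=\inf\{p\in[0,1]: h(p)\ge t\}$. The permutation group of $\mathcal{C}$ is the group of coordinate permutations that map codewords to codewords. It is doubly transitive if for all distinct positions $i,j,k$ it contains $\pi$ with $\pi(i)=i$ and $\pi(j)=k$. The code is affine-invariant if there are a finite extension field $E$ of $\mathbb{F}_q$ and a bijection $\Theta$ from the set of positions to $E$ (so $N=q^m$) such that every permutation $\ell\mapsto\Theta^{-1}(\beta\Theta(\ell)+\gamma)$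 with $\beta,\gamma\in E$, $\beta\ne0$, belongs to the permutation group. The code is proper if no position is zero in all codewords. **Theorem.** There is an absolute constant $K_0>0$ such that for every finite field $\mathbb{F}_q$ the following hold. 1. If $\mathcal{C}$ is a proper $\mathbb{F}_q$-linear code of length $N\ge1$ with minimum distance at least $2$ and doubly transitive permutation group, then for all $0<\varepsilon\le\frac12$ $$p_{1-\varepsilon}-p_{\varepsilon}\le K_0\,\frac{\log\frac{1-\varepsilon}{\varepsilon}}{\log N}.$$ 2. Let $\{\mathcal{C}_n\}$ be a sequence of $\mathbb{F}_q$-linear codes with blocklengths $N_n\to\infty$, rates converging to some $r\in(0,1)$, and doubly transitive permutation groups. Then $\{\mathcal{C}_n\}$ is capacity achieving on the $q$-ary erasure channel under symbol-MAP decoding, i.e. $\lim_{n\to\infty}P_b^{(n)}(p)=0$ for every $p\in[0,1-r)$. Moreover, for all sufficiently large $n$ and all $0<\varepsilon\le\frac12$, $p^{(n)}_{1-\varepsilon}-p^{(n)}_{\varepsilon}\le K_0\log\frac{1-\varepsilon}{\varepsilon}/\log N_n$. 3. The conclusions of part 2 hold if "doubly transitive permutation groups" is replaced by "the codes $\mathcal{C}_n$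 are affine-invariant". For $q=2$ this is the statement for binary linear codes on the binary erasure channel $\mathrm{BEC}(p)$ under bit-MAP decoding. -/

import Mathlib

open Filter Topology

/-- Transition probabilities of the erasure channel with input alphabet `F` and erasure
probability `p`: the input symbol `a` is received as an erasure (`none`) with probability `p`
and correctly (`some a`) with probability `1 - p`. For `F` with two elements this is `BEC(p)`. -/
noncomputable def erasureKernel {F : Type*} (p : ℝ) (a : F) : Option F → ℝ
  | none => p
  | some b => open Classical in if b = a then 1 - p else 0

/-- Joint probability `Pr(X = x, Y = y)`, where `X` is a uniformly random codeword of `C` and `Y` is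
obtained by sending `X` through the memoryless erasure channel with erasure probability `p`. -/
noncomputable def jointProb {F : Type*} [Field F] {N : ℕ} (C : Submodule F (Fin N → F)) (p : ℝ)
    (x : Fin N → F) (y : Fin N → Option F) : ℝ :=
  open Classical in
  (if x ∈ C then (Nat.card C : ℝ)⁻¹ else 0) * ∏ i, erasureKernel p (x i) (y i)

/-- Probability of an event that depends on the sent codeword and the received word. -/
noncomputable def eventProb {F : Type*} [Field F] [Fintype F] {N : ℕ}
    (C : Submodule F (Fin N → F)) (p : ℝ)
    (E : (Fin N → F) → (Fin N → Option F) → Prop) : ℝ :=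
  open Classical in
  ∑ x : Fin N → F, ∑ y : Fin N → Option F, if E x y then jointProb C p x y else 0

/-- Conditional entropy `H(U | V) = ∑ v, Pr(V = v) * H(U | V = v)`, with logarithms to base
`q = |F|`, of a function `U` of the sent codeword given a function `V` of the received word. -/
noncomputable def condEntropy {F : Type*} [Field F] [Fintype F] {N : ℕ}
    (C : Submodule F (Fin N → F)) (p : ℝ) {α β : Type*} [Fintype α] [Fintype β]
    (U : (Fin N → F) → α) (V : (Fin N → Option F) → β) : ℝ :=
  ∑ v : β, eventProb C p (fun _ y => V y = v) *
    ∑ u : α, Real.negMulLog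
      (eventProb C p (fun x y => U x = u ∧ V y = v) / eventProb C p (fun _ y => V y = v)) /
        Real.log (Fintype.card F)

/-- The EXIT function `h_i(p) = H(X_i | Y_{∼i})` of symbol `i`. -/
noncomputable def exitFunction {F : Type*} [Field F] [Fintype F] {N : ℕ}
    (C : Submodule F (Fin N → F)) (i : Fin N) (p : ℝ) : ℝ :=
  condEntropy C p (fun x => x i) (fun y (j : {j : Fin N // j ≠ i}) => y j)

/-- The average EXIT function `h(p)`. -/
noncomputable def avgExitFunction {F : Type*} [Field F] [Fintype F] {N : ℕ}
    (C : Submodule F (Fin N → F)) (p : ℝ) : ℝ :=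
  (1 / (N : ℝ)) * ∑ i, exitFunction C i p

/-- The inverse `p_t = inf {p ∈ [0,1] | h(p) ≥ t}` of the average EXIT function. -/
noncomputable def exitInverse {F : Type*} [Field F] [Fintype F] {N : ℕ}
    (C : Submodule F (Fin N → F)) (t : ℝ) : ℝ :=
  sInf {p : ℝ | p ∈ Set.Icc (0 : ℝ) 1 ∧ t ≤ avgExitFunction C p}

/-- Length of the interval on which the average EXIT function goes from `ε` to `1 - ε`. -/
noncomputable def transitionWidth {F : Type*} [Field F] [Fintype F] {N : ℕ}
    (C : Submodule F (Fin N → F)) (ε : ℝ) : ℝ :=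
  exitInverse C (1 - ε) - exitInverse C ε

/-- The word `x` agrees with the received word `y` on all unerased positions. -/
def Compatible {F : Type*} {N : ℕ} (x : Fin N → F) (y : Fin N → Option F) : Prop :=
  ∀ j, y j = none ∨ y j = some (x j)

/-- The symbol-MAP decoder for symbol `i`: it returns the `i`-th symbol of the sent codeword if
that symbol is uniquely determined by the received word, and an erasure (`none`) otherwise. -/
noncomputable def symbolMAP {F : Type*} [Field F] {N : ℕ} (C : Submodule F (Fin N → F))
    (i : Fin N) (y : Fin N → Option F) : Option F :=
  open Classical in
  if h : ∃! a : F, ∃ x ∈ C, Compatible x y ∧ x i = a then some h.choose else none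

/-- The erasure probability `P_{b,i}(p)` of symbol `i` under symbol-MAP decoding. -/
noncomputable def symbolErasureProb {F : Type*} [Field F] [Fintype F] {N : ℕ}
    (C : Submodule F (Fin N → F)) (i : Fin N) (p : ℝ) : ℝ :=
  eventProb C p (fun x y => symbolMAP C i y ≠ some (x i))

/-- The average symbol (for `q = 2`: bit) erasure probability `P_b(p)`. -/
noncomputable def avgErasureProb {F : Type*} [Field F] [Fintype F] {N : ℕ}
    (C : Submodule F (Fin N → F)) (p : ℝ) : ℝ :=
  (1 / (N : ℝ)) * ∑ i, symbolErasureProb C i p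

/-- The rate `K / N` of a linear code. -/
noncomputable def codeRate {F : Type*} [Field F] {N : ℕ} (C : Submodule F (Fin N → F)) : ℝ :=
  (Module.finrank F C : ℝ) / (N : ℝ)

/-- A code is proper if no position is zero in all codewords. -/
def IsProperCode {F : Type*} [Field F] {N : ℕ} (C : Submodule F (Fin N → F)) : Prop :=
  ∀ i, ∃ c ∈ C, c i ≠ 0

/-- The minimum distance of the code is at least `d`. -/
def MinDistAtLeast {F : Type*} [Field F] {N : ℕ} (C : Submodule F (Fin N → F)) (d : ℕ) : Prop :=
  open Classical in
  ∀ x ∈ C, ∀ y ∈ C, x ≠ y → d ≤ hammingDist x y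

/-- The permutation group of a code: the coordinate permutations that map codewords to codewords.
The word `π(c)`, whose `π(i)`-th entry is `c i`, is `c ∘ π⁻¹`. -/
def permGroup {F : Type*} [Field F] {N : ℕ} (C : Submodule F (Fin N → F)) :
    Subgroup (Equiv.Perm (Fin N)) where
  carrier := {π | ∀ c ∈ C, c ∘ ⇑π⁻¹ ∈ C}
  mul_mem' := by
    intro a b ha hb c hc
    have := ha _ (hb c hc)
    simpa [Function.comp_assoc, mul_inv_rev, Equiv.Perm.coe_mul] using this
  one_mem' := by
    intro c hc
    simpa using hc
  inv_mem' := by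
    intro a ha
    have hpow : ∀ n : ℕ, ∀ c ∈ C, c ∘ ⇑(a ^ n)⁻¹ ∈ C := by
      intro n
      induction n with
      | zero => intro c hc; simpa using hc
      | succ n ih =>
        intro c hc
        have := ih _ (ha c hc)
        simpa [Function.comp_assoc, pow_succ, mul_inv_rev, Equiv.Perm.coe_mul] using this
    have hinv : a⁻¹ = a ^ (orderOf a - 1) := by
      rw [inv_eq_iff_mul_eq_one, ← pow_succ', Nat.sub_add_cancel (orderOf_pos a),
        pow_orderOf_eq_one]
    intro c hc
    rw [hinv]
    exact hpow _ c hc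

/-- Double transitivity of a permutation group on the positions. -/
def IsDoublyTransitive {N : ℕ} (G : Subgroup (Equiv.Perm (Fin N))) : Prop :=
  ∀ i j k : Fin N, i ≠ j → i ≠ k → j ≠ k → ∃ π ∈ G, π i = i ∧ π j = k

/-- The permutation `ℓ ↦ Θ⁻¹ (β * Θ ℓ + γ)` of the positions. -/
def affinePerm {N : ℕ} {E : Type*} [Field E] (Θ : Fin N ≃ E) (β γ : E) (hβ : β ≠ 0) :
    Equiv.Perm (Fin N) :=
  (Θ.trans ((Equiv.mulLeft₀ β hβ).trans (Equiv.addRight γ))).trans Θ.symm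

/-- Affine-invariant codes: the positions can be labelled bijectively by the elements of a finite
extension field `E` of `F` (so that the length is `N = q ^ m`) in such a way that all the
permutations `ℓ ↦ Θ⁻¹ (β * Θ ℓ + γ)`, `β ≠ 0`, belong to the permutation group. -/
def IsAffineInvariant {F : Type*} [Field F] {N : ℕ} (C : Submodule F (Fin N → F)) : Prop :=
  ∃ (E : Type) (_ : Field E) (_ : Algebra F E) (Θ : Fin N ≃ E),
    ∀ (β γ : E) (hβ : β ≠ 0), affinePerm Θ β γ hβ ∈ permGroup C

/-- A sequence of codes with rates converging to `r` is capacity achieving on the erasure channel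
under symbol-MAP decoding (for `q = 2`: on the BEC under bit-MAP decoding) if the average erasure
probability tends to zero for every channel erasure probability `p ∈ [0, 1 - r)`. -/
def IsCapacityAchieving {F : Type*} [Field F] [Fintype F] {N : ℕ → ℕ}
    (C : ∀ n, Submodule F (Fin (N n) → F)) (r : ℝ) : Prop :=
  ∀ p : ℝ, 0 ≤ p → p < 1 - r → Tendsto (fun n => avgErasureProb (C n) p) atTop (𝓝 0)

/-! Over an erasure channel the posterior of X_i given the other outputs is either uniform or a
point mass. Hence h_i(p) is the p-biased measure of a monotone family of erasure patterns, those
leaving position i undetermined (`exitFunction_eq`), and the claim is about a sharp threshold and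
its location.

Sharpness: the stabilizer of i is transitive on the other positions, so all influences on h_i except
that of i itself (which is zero) coincide. A Talagrand-type inequality (`variance_mul_log_le`) then
bounds the total influence below by c log N · h(1 - h). It comes from a logarithmic Sobolev
inequality with a constant independent of p, applied to martingale differences. By Margulis–Russo
the total influence is h', so the logit of h grows at rate at least c log N, which bounds the width
(`width_le_of_deriv_ge`).

Location: the expected dimension of the subcode supported on the erased positions has derivative N
h(p). Integrating gives the area bound `mul_one_sub_le_codeRate`. If h(p) stayed away from 0 for
some p < 1 - r, then h would be nearly 1 from just beyond p on, and the area would exceed the rate.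
Since the erasure probability is at most h, it tends to 0. -/

/-- The expectation of `f` with respect to the product of `n` Bernoulli measures with
parameter `p`. -/
noncomputable def biasedExp (p : ℝ) {n : ℕ} (f : (Fin n → Bool) → ℝ) : ℝ :=
  ∑ x : Fin n → Bool, (∏ i, if x i = true then p else 1 - p) * f x

/-- The discrete derivative of `f` in direction `j`. -/
def coordDiff {n : ℕ} (j : Fin n) (f : (Fin n → Bool) → ℝ) (x : Fin n → Bool) : ℝ :=
  f (Function.update x j true) - f (Function.update x j false)

/-! ### Analysis on the biased cube: Margulis–Russo, log-Sobolev and Talagrand-type inequalities. -/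

section BiasedExp

variable {p : ℝ} {n : ℕ}

theorem biasedExp_zero (f : (Fin 0 → Bool) → ℝ) : biasedExp p f = f default := by
  rw [biasedExp, Fintype.sum_subsingleton _ default]
  simp

theorem biasedExp_succ (f : (Fin (n + 1) → Bool) → ℝ) :
    biasedExp p f = p * biasedExp p (fun x => f (Fin.cons true x)) +
      (1 - p) * biasedExp p (fun x => f (Fin.cons false x)) := by
  unfold biasedExp
  rw [← (Fin.consEquiv fun _ : Fin (n + 1) => Bool).sum_comp, Fintype.sum_prod_type,
    Fintype.sum_bool, Finset.mul_sum, Finset.mul_sum]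
  simp [Fin.consEquiv, Fin.prod_univ_succ, mul_assoc]

theorem biasedExp_add (f g : (Fin n → Bool) → ℝ) :
    biasedExp p (fun x => f x + g x) = biasedExp p f + biasedExp p g := by
  simp [biasedExp, mul_add, Finset.sum_add_distrib]

theorem biasedExp_sub (f g : (Fin n → Bool) → ℝ) :
    biasedExp p (fun x => f x - g x) = biasedExp p f - biasedExp p g := by
  simp [biasedExp, mul_sub, Finset.sum_sub_distrib]

theorem biasedExp_const_mul (c : ℝ) (f : (Fin n → Bool) → ℝ) :
    biasedExp p (fun x => c * f x) = c * biasedExp p f := by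
  simp [biasedExp, Finset.mul_sum, mul_left_comm]

theorem biasedExp_sum {ι : Type*} (s : Finset ι) (f : ι → (Fin n → Bool) → ℝ) :
    biasedExp p (fun x => ∑ i ∈ s, f i x) = ∑ i ∈ s, biasedExp p (f i) := by
  simp only [biasedExp, Finset.mul_sum]
  exact Finset.sum_comm

theorem biasedExp_const (c : ℝ) : biasedExp p (fun _ : Fin n → Bool => c) = c := by
  induction n with
  | zero => exact biasedExp_zero _
  | succ n ih => rw [biasedExp_succ, ih]; ring

theorem biasedExp_mono (h0 : 0 ≤ p) (h1 : p ≤ 1) {f g : (Fin n → Bool) → ℝ}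
    (h : ∀ x, f x ≤ g x) : biasedExp p f ≤ biasedExp p g := by
  refine Finset.sum_le_sum fun x _ => mul_le_mul_of_nonneg_left (h x) ?_
  refine Finset.prod_nonneg fun i _ => ?_
  split_ifs <;> linarith

theorem biasedExp_nonneg (h0 : 0 ≤ p) (h1 : p ≤ 1) {f : (Fin n → Bool) → ℝ}
    (h : ∀ x, 0 ≤ f x) : 0 ≤ biasedExp p f := by
  simpa [biasedExp_const] using biasedExp_mono h0 h1 (f := fun _ => 0) h

theorem biasedExp_comp_perm (π : Equiv.Perm (Fin n)) (f : (Fin n → Bool) → ℝ) :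
    biasedExp p (fun x => f (x ∘ π)) = biasedExp p f := by
  unfold biasedExp
  rw [← (Equiv.arrowCongr π (Equiv.refl Bool)).sum_comp]
  refine Finset.sum_congr rfl fun x _ => ?_
  have h : (Equiv.arrowCongr π (Equiv.refl Bool) x) ∘ π = x := by
    funext i
    simp [Equiv.arrowCongr]
  beta_reduce
  rw [h]
  congr 1
  exact Equiv.prod_comp π.symm fun i => if x i = true then p else 1 - p

theorem coordDiff_zero_cons (f : (Fin (n + 1) → Bool) → ℝ) (b : Bool) (x : Fin n → Bool) :
    coordDiff 0 f (Fin.cons b x) = f (Fin.cons true x) - f (Fin.cons false x) := by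
  simp [coordDiff]

theorem coordDiff_succ_cons (f : (Fin (n + 1) → Bool) → ℝ) (j : Fin n) (b : Bool)
    (x : Fin n → Bool) :
    coordDiff j.succ f (Fin.cons b x) = coordDiff j (fun y => f (Fin.cons b y)) x := by
  simp [coordDiff, Fin.cons_update]

/-- The Margulis–Russo formula. -/
theorem hasDerivAt_biasedExp (f : (Fin n → Bool) → ℝ) (p : ℝ) :
    HasDerivAt (fun p => biasedExp p f) (∑ j, biasedExp p (coordDiff j f)) p := by
  induction n with
  | zero => simpa [biasedExp_zero] using hasDerivAt_const p (f default)
  | succ n ih =>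
    have h := ((hasDerivAt_id p).mul (ih fun x => f (Fin.cons true x))).add
      (((hasDerivAt_id p).const_sub 1).mul (ih fun x => f (Fin.cons false x)))
    refine (h.congr_deriv ?_).congr_of_eventuallyEq ?_
    · simp only [Fin.sum_univ_succ, biasedExp_succ (f := coordDiff _ f), coordDiff_zero_cons,
        coordDiff_succ_cons, biasedExp_sub, Finset.sum_add_distrib, ← Finset.mul_sum, id]
      ring
    · exact Eventually.of_forall fun q => by simpa using biasedExp_succ f

/-- For a ≤ 2b, linear bounds on the logarithm around b² reduce the entropy to p(a - b)²((a +
b)/b)², and (a + b)/b ≤ 3 gives the 9. For a > 2b, the bound p log(1/p) ≤ 1 makes the entropy at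
most a², which is less than 4(a - b)². -/
theorem sq_entropy_two_point_of_le {a b : ℝ} (h0 : 0 ≤ p) (h1 : p ≤ 1) (hb : 0 ≤ b)
    (hab : b ≤ a) :
    p * (a ^ 2 * Real.log (a ^ 2)) + (1 - p) * (b ^ 2 * Real.log (b ^ 2)) -
      (p * a ^ 2 + (1 - p) * b ^ 2) * Real.log (p * a ^ 2 + (1 - p) * b ^ 2) ≤ 9 * (a - b) ^ 2 := by
  set m := p * a ^ 2 + (1 - p) * b ^ 2 with hm
  have hsq : b ^ 2 ≤ a ^ 2 := by gcongr
  have hbm : b ^ 2 ≤ m := by nlinarith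
  rcases le_or_gt a (2 * b) with h2 | h2
  · rcases hb.eq_or_lt with rfl | hb
    · have : a = 0 := by linarith
      simp [this, hm]
    have ha : 0 < a := by linarith
    have hm0 : 0 < m := lt_of_lt_of_le (by positivity) hbm
    have e1 : m * Real.log (b ^ 2) + m - b ^ 2 ≤ m * Real.log m := by
      have := Real.one_sub_inv_le_log_of_pos (div_pos hm0 (pow_pos hb 2))
      rw [Real.log_div hm0.ne' (by positivity), inv_div] at this
      have := mul_le_mul_of_nonneg_left this hm0.le
      have e : m * (1 - b ^ 2 / m) = m - b ^ 2 := by field_simp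
      nlinarith
    have e2 : a ^ 2 * Real.log (a ^ 2) ≤ a ^ 2 * Real.log (b ^ 2) + a ^ 2 * (a ^ 2 / b ^ 2 - 1) := by
      have := Real.log_le_sub_one_of_pos (div_pos (pow_pos ha 2) (pow_pos hb 2))
      rw [Real.log_div (by positivity) (by positivity)] at this
      have := mul_le_mul_of_nonneg_left this (sq_nonneg a)
      nlinarith
    have e3 : a ^ 2 * (a ^ 2 / b ^ 2 - 1) - a ^ 2 + b ^ 2 ≤ 9 * (a - b) ^ 2 := by
      have : a ^ 2 * (a ^ 2 / b ^ 2 - 1) - a ^ 2 + b ^ 2 = (a - b) ^ 2 * ((a + b) / b) ^ 2 := by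
        field_simp; ring
      rw [this]
      have h3 : (a + b) / b ≤ 3 := by rw [div_le_iff₀ hb]; linarith
      have h4 : ((a + b) / b) ^ 2 ≤ 3 ^ 2 := by gcongr
      nlinarith [sq_nonneg (a - b)]
    have e4 := mul_le_mul_of_nonneg_left e2 h0
    have e5 := mul_le_mul_of_nonneg_left e3 h0
    have e6 : p * (9 * (a - b) ^ 2) ≤ 9 * (a - b) ^ 2 := by nlinarith [sq_nonneg (a - b)]
    have e7 : (m * Real.log (b ^ 2) : ℝ) =
      p * (a ^ 2 * Real.log (b ^ 2)) + (1 - p) * (b ^ 2 * Real.log (b ^ 2)) := by rw [hm]; ring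
    nlinarith
  · have ha : 0 < a := by linarith
    have e1 : b ^ 2 * Real.log (b ^ 2) ≤ b ^ 2 * Real.log m := by
      rcases hb.eq_or_lt with rfl | hb
      · simp
      · gcongr
    have e2 : p * (a ^ 2 * Real.log (a ^ 2)) ≤ p * (a ^ 2 * Real.log m) + a ^ 2 := by
      rcases h0.eq_or_lt with rfl | h0
      · simp; positivity
      have hpm : p * a ^ 2 ≤ m := by rw [hm]; nlinarith [sq_nonneg b]
      have l1 : Real.log (p * a ^ 2) ≤ Real.log m := Real.log_le_log (by positivity) hpm
      rw [Real.log_mul h0.ne' (by positivity)] at l1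
      have l2 := Real.one_sub_inv_le_log_of_pos h0
      have l3 : p * (1 - p⁻¹) = p - 1 := by field_simp
      have l4 : p * Real.log (a ^ 2) ≤ p * Real.log m + 1 := by nlinarith
      nlinarith [sq_nonneg a]
    have e3 := mul_le_mul_of_nonneg_left e1 (sub_nonneg.2 h1)
    have e4 : a ^ 2 ≤ 9 * (a - b) ^ 2 := by nlinarith
    have e5 : m * Real.log m = p * (a ^ 2 * Real.log m) + (1 - p) * (b ^ 2 * Real.log m) := by
      rw [hm]; ring
    linarith

/-- A logarithmic Sobolev inequality on the two-point space, uniform in the bias. -/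
theorem sq_entropy_two_point_le (h0 : 0 ≤ p) (h1 : p ≤ 1) (a b : ℝ) :
    p * (a ^ 2 * Real.log (a ^ 2)) + (1 - p) * (b ^ 2 * Real.log (b ^ 2)) -
      (p * a ^ 2 + (1 - p) * b ^ 2) * Real.log (p * a ^ 2 + (1 - p) * b ^ 2) ≤ 9 * (a - b) ^ 2 := by
  -- Passing to absolute values keeps the left side and shrinks the right; exchanging p with 1 - p
  -- then allows |b| ≤ |a|.
  have key : (|a| - |b|) ^ 2 ≤ (a - b) ^ 2 := sq_le_sq.2 (abs_abs_sub_abs_le_abs_sub a b)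
  rcases le_total |b| |a| with h | h
  · have := sq_entropy_two_point_of_le h0 h1 (abs_nonneg b) h
    simp only [sq_abs] at this
    linarith
  · have := sq_entropy_two_point_of_le (sub_nonneg.2 h1) (by linarith) (abs_nonneg a) h
    simp only [sq_abs, sub_sub_cancel] at this
    rw [add_comm ((1 - p) * b ^ 2)] at this
    nlinarith

/-- This is the reverse triangle inequality for the weighted Euclidean norm on two points. It shows
that taking the quadratic mean over one coordinate does not increase the energy in the others. -/
theorem sqrt_sub_sqrt_sq_le (h0 : 0 ≤ p) (h1 : p ≤ 1) (a b c d : ℝ) :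
    (√(p * a ^ 2 + (1 - p) * b ^ 2) - √(p * c ^ 2 + (1 - p) * d ^ 2)) ^ 2 ≤
      p * (a - c) ^ 2 + (1 - p) * (b - d) ^ 2 := by
  have hq : 0 ≤ 1 - p := sub_nonneg.2 h1
  have hA : 0 ≤ p * a ^ 2 + (1 - p) * b ^ 2 := by positivity
  have hB : 0 ≤ p * c ^ 2 + (1 - p) * d ^ 2 := by positivity
  have key : p * (a * c) + (1 - p) * (b * d) ≤
      √(p * a ^ 2 + (1 - p) * b ^ 2) * √(p * c ^ 2 + (1 - p) * d ^ 2) := by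
    rw [← Real.sqrt_mul hA]
    refine Real.le_sqrt_of_sq_le ?_
    have : 0 ≤ p * (1 - p) * (a * d - b * c) ^ 2 := by positivity
    nlinarith
  nlinarith [Real.sq_sqrt hA, Real.sq_sqrt hB]

/-- A logarithmic Sobolev inequality on the discrete cube, uniform in the bias. -/
theorem sq_entropy_le (h0 : 0 ≤ p) (h1 : p ≤ 1) (g : (Fin n → Bool) → ℝ) :
    biasedExp p (fun x => g x ^ 2 * Real.log (g x ^ 2)) -
      biasedExp p (fun x => g x ^ 2) * Real.log (biasedExp p fun x => g x ^ 2) ≤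
      9 * ∑ j, biasedExp p (fun x => coordDiff j g x ^ 2) := by
  induction n with
  | zero => simp [biasedExp_zero]
  | succ n ih =>
    set g₁ : (Fin n → Bool) → ℝ := fun x => g (Fin.cons true x) with hg₁
    set g₀ : (Fin n → Bool) → ℝ := fun x => g (Fin.cons false x) with hg₀
    have hq : 0 ≤ 1 - p := sub_nonneg.2 h1
    have hG : ∀ x, √(p * g₁ x ^ 2 + (1 - p) * g₀ x ^ 2) ^ 2 = p * g₁ x ^ 2 + (1 - p) * g₀ x ^ 2 :=
      fun x => Real.sq_sqrt (by positivity)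
    -- Chain rule for entropy: the entropy of g² is the mean of its two-point entropies in the first
    -- coordinate plus the entropy of its average over that coordinate. The induction hypothesis
    -- handles the latter through its square root.
    have key := ih fun x => √(p * g₁ x ^ 2 + (1 - p) * g₀ x ^ 2)
    simp only [hG] at key
    have e1 := biasedExp_mono h0 h1 fun x => sq_entropy_two_point_le h0 h1 (g₁ x) (g₀ x)
    have e2 : ∑ j, biasedExp p (fun x =>
          coordDiff j (fun x => √(p * g₁ x ^ 2 + (1 - p) * g₀ x ^ 2)) x ^ 2) ≤
        ∑ j, (p * biasedExp p (fun x => coordDiff j g₁ x ^ 2) +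
          (1 - p) * biasedExp p (fun x => coordDiff j g₀ x ^ 2)) := by
      refine Finset.sum_le_sum fun j _ => ?_
      rw [← biasedExp_const_mul, ← biasedExp_const_mul, ← biasedExp_add]
      exact biasedExp_mono h0 h1 fun x => sqrt_sub_sqrt_sq_le h0 h1 _ _ _ _
    simp only [biasedExp_succ (n := n), Fin.sum_univ_succ, coordDiff_zero_cons,
      coordDiff_succ_cons, ← hg₁, ← hg₀]
    simp only [biasedExp_sub, biasedExp_add, biasedExp_const_mul] at e1 key ⊢
    have e3 : biasedExp p (fun x => (g (Fin.cons true x) - g (Fin.cons false x)) ^ 2) =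
      biasedExp p (fun x => (g₁ x - g₀ x) ^ 2) := rfl
    simp only [e3]
    linarith

/-- The tangent-type bound d² log d² ≥ (2 log c + 2)d² - 2c|d| is averaged with c = √(tm), m being
the mean of d², and 2√(tm)e ≤ m + te² finishes. A function with small L¹ norm relative to its L²
norm thus has large entropy. -/
theorem le_sq_entropy (h0 : 0 ≤ p) (h1 : p ≤ 1) (d : (Fin n → Bool) → ℝ) {t : ℝ} (ht : 0 < t) :
    biasedExp p (fun x => d x ^ 2) * (Real.log t + 1) - t * biasedExp p (fun x => |d x|) ^ 2 ≤
      biasedExp p (fun x => d x ^ 2 * Real.log (d x ^ 2)) -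
      biasedExp p (fun x => d x ^ 2) * Real.log (biasedExp p fun x => d x ^ 2) := by
  set m := biasedExp p (fun x => d x ^ 2)
  set e := biasedExp p (fun x => |d x|) with he_def
  have hm : 0 ≤ m := biasedExp_nonneg h0 h1 fun x => sq_nonneg _
  have he : 0 ≤ e := biasedExp_nonneg h0 h1 fun x => abs_nonneg _
  have key : ∀ c : ℝ, 0 < c →
      (2 * Real.log c + 2) * m - 2 * c * e ≤ biasedExp p (fun x => d x ^ 2 * Real.log (d x ^ 2)) := by
    intro c hc
    rw [← biasedExp_const_mul, ← biasedExp_const_mul, ← biasedExp_sub]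
    refine biasedExp_mono h0 h1 fun x => ?_
    rcases eq_or_ne (d x) 0 with h | h
    · simp [h]
    · have hd : 0 < |d x| := abs_pos.2 h
      have := Real.one_sub_inv_le_log_of_pos (div_pos hd hc)
      rw [Real.log_div hd.ne' hc.ne', inv_div] at this
      have := mul_le_mul_of_nonneg_left this (sq_nonneg |d x|)
      have e : |d x| ^ 2 * (1 - c / |d x|) = |d x| ^ 2 - c * |d x| := by field_simp
      rw [← sq_abs, Real.log_pow]
      push_cast
      nlinarith
  rcases hm.eq_or_lt with hm | hm
  · rw [← hm] at key ⊢
    rcases he.eq_or_lt with he | he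
    · have := key 1 one_pos
      rw [← he] at this ⊢
      simpa using this
    -- With m = 0 this choice of c makes 2ce equal to te², so there is no need to show that e
    -- vanishes.
    · have := key (t * e / 2) (by positivity)
      nlinarith
  · have := key (√t * √m) (by positivity)
    rw [Real.log_mul (by positivity) (by positivity), Real.log_sqrt ht.le, Real.log_sqrt hm.le] at this
    nlinarith [sq_nonneg (√m - √t * e), Real.sq_sqrt ht.le, Real.sq_sqrt hm.le]

/-- An inequality of Talagrand type on the biased cube, in linearized form. -/
theorem variance_mul_log_le (h0 : 0 ≤ p) (h1 : p ≤ 1) (f : (Fin n → Bool) → ℝ) {t : ℝ}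
    (ht : 0 < t) :
    (biasedExp p (fun x => f x ^ 2) - biasedExp p f ^ 2) * (Real.log t + 1) -
      t * ∑ j, (biasedExp p (fun x => |coordDiff j f x|) / 2) ^ 2 ≤
      9 * ∑ j, biasedExp p (fun x => coordDiff j f x ^ 2) := by
  induction n with
  | zero => simp [biasedExp_zero]
  | succ n ih =>
    set f₁ : (Fin n → Bool) → ℝ := fun x => f (Fin.cons true x) with hf₁
    set f₀ : (Fin n → Bool) → ℝ := fun x => f (Fin.cons false x) with hf₀
    have hq : 0 ≤ 1 - p := sub_nonneg.2 h1
    set g : (Fin n → Bool) → ℝ := fun x => p * f₁ x + (1 - p) * f₀ x with hg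
    -- `d` is the martingale difference for the first coordinate. By orthogonality both the variance
    -- and the energy in the later coordinates split into a `g` part and a `d` part; induction
    -- treats `g`, and the entropy bounds treat `d`.
    set d : (Fin (n + 1) → Bool) → ℝ := fun x => f x - g (Fin.tail x) with hd
    have hd₁ : ∀ x, d (Fin.cons true x) = (1 - p) * (f₁ x - f₀ x) := fun x => by
      simp only [hd, hg, Fin.tail_cons, hf₁, hf₀]; ring
    have hd₀ : ∀ x, d (Fin.cons false x) = - p * (f₁ x - f₀ x) := fun x => by
      simp only [hd, hg, Fin.tail_cons, hf₁, hf₀]; ring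
    have kg := ih g
    have kd := (le_sq_entropy h0 h1 d ht).trans (sq_entropy_le h0 h1 d)
    have eg : ∀ j, ∀ x, coordDiff j g x = p * coordDiff j f₁ x + (1 - p) * coordDiff j f₀ x :=
      fun j x => by simp only [coordDiff, hg]; ring
    have e1 : ∑ j, (biasedExp p (fun x => |coordDiff j g x|) / 2) ^ 2 ≤
        ∑ j, ((p * biasedExp p (fun x => |coordDiff j f₁ x|) +
          (1 - p) * biasedExp p (fun x => |coordDiff j f₀ x|)) / 2) ^ 2 := by
      refine Finset.sum_le_sum fun j _ => ?_
      have : 0 ≤ biasedExp p (fun x => |coordDiff j g x|) :=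
        biasedExp_nonneg h0 h1 fun x => abs_nonneg _
      gcongr
      rw [← biasedExp_const_mul, ← biasedExp_const_mul, ← biasedExp_add]
      refine biasedExp_mono h0 h1 fun x => ?_
      rw [eg]
      refine (abs_add_le _ _).trans_eq ?_
      rw [abs_mul, abs_mul, abs_of_nonneg h0, abs_of_nonneg hq]
    have e2 : biasedExp p f = biasedExp p g := by
      rw [biasedExp_succ, hg, biasedExp_add, biasedExp_const_mul, biasedExp_const_mul]
    have e3 : biasedExp p (fun x => f x ^ 2) =
        biasedExp p (fun x => g x ^ 2) + biasedExp p (fun x => d x ^ 2) := by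
      simp only [biasedExp_succ (n := n), hd₁, hd₀]
      rw [← biasedExp_const_mul, ← biasedExp_const_mul, ← biasedExp_const_mul,
        ← biasedExp_const_mul, ← biasedExp_add, ← biasedExp_add, ← biasedExp_add]
      congr 1; ext x; simp only [hg, hf₁, hf₀]; ring
    -- The mean of |d| is 2p(1 - p) times that of |f₁ - f₀|, and 2p(1 - p) ≤ 1/2; this is the source
    -- of the halves in the statement.
    have e4 : biasedExp p (fun x => |d x|) ^ 2 ≤ (biasedExp p (fun x => |f₁ x - f₀ x|) / 2) ^ 2 := by
      have : 0 ≤ biasedExp p (fun x => |d x|) := biasedExp_nonneg h0 h1 fun x => abs_nonneg _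
      gcongr
      simp only [biasedExp_succ (n := n), hd₁, hd₀, abs_mul, abs_neg, abs_of_nonneg h0,
        abs_of_nonneg hq, biasedExp_const_mul]
      have : 0 ≤ biasedExp p (fun x => |f₁ x - f₀ x|) := biasedExp_nonneg h0 h1 fun x => abs_nonneg _
      nlinarith [sq_nonneg (2 * p - 1)]
    have e5 : ∀ j : Fin n, p * biasedExp p (fun x => coordDiff j f₁ x ^ 2) +
        (1 - p) * biasedExp p (fun x => coordDiff j f₀ x ^ 2) =
        biasedExp p (fun x => coordDiff j g x ^ 2) +
          biasedExp p (fun x => coordDiff j.succ d x ^ 2) := fun j => by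
      simp only [biasedExp_succ (n := n), coordDiff_succ_cons, hd₁, hd₀, eg]
      rw [← biasedExp_const_mul, ← biasedExp_const_mul, ← biasedExp_const_mul,
        ← biasedExp_const_mul, ← biasedExp_add, ← biasedExp_add, ← biasedExp_add]
      congr 1; ext x; simp only [coordDiff]; ring
    have e6 : biasedExp p (fun x => coordDiff 0 d x ^ 2) =
        biasedExp p (fun x => (f₁ x - f₀ x) ^ 2) := by
      simp only [biasedExp_succ (n := n), coordDiff_zero_cons, hd₁, hd₀]
      rw [← biasedExp_const_mul, ← biasedExp_const_mul, ← biasedExp_add]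
      congr 1; ext x; ring
    have e7 : biasedExp p (fun x => coordDiff 0 f x ^ 2) =
        biasedExp p (fun x => (f₁ x - f₀ x) ^ 2) := by
      simp only [biasedExp_succ (n := n), coordDiff_zero_cons, hf₁, hf₀]; ring
    have e8 : biasedExp p (fun x => |coordDiff 0 f x|) =
        biasedExp p (fun x => |f₁ x - f₀ x|) := by
      simp only [biasedExp_succ (n := n), coordDiff_zero_cons, hf₁, hf₀]; ring
    have e9 : ∑ j : Fin n, biasedExp p (fun x => coordDiff j.succ f x ^ 2) =
        ∑ j, biasedExp p (fun x => coordDiff j g x ^ 2) +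
          ∑ j : Fin n, biasedExp p (fun x => coordDiff j.succ d x ^ 2) := by
      rw [← Finset.sum_add_distrib]
      refine Finset.sum_congr rfl fun j _ => ?_
      rw [← e5, biasedExp_succ]
      simp only [coordDiff_succ_cons, hf₁, hf₀]
    have e10 : ∑ j : Fin n, (biasedExp p (fun x => |coordDiff j.succ f x|) / 2) ^ 2 =
        ∑ j, ((p * biasedExp p (fun x => |coordDiff j f₁ x|) +
          (1 - p) * biasedExp p (fun x => |coordDiff j f₀ x|)) / 2) ^ 2 := by
      refine Finset.sum_congr rfl fun j _ => ?_
      rw [biasedExp_succ]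
      simp only [coordDiff_succ_cons, hf₁, hf₀]
    rw [Fin.sum_univ_succ] at kd
    rw [Fin.sum_univ_succ, Fin.sum_univ_succ, e2, e3, e7, e8, e9, e10]
    rw [e6] at kd
    have e11 := mul_le_mul_of_nonneg_left e1 ht.le
    have e12 := mul_le_mul_of_nonneg_left e4 ht.le
    linarith

end BiasedExp

/-! ### Monotonicity, symmetry and linear algebra of undetermined positions. -/

section ErasurePatterns

variable {F : Type*} [Field F] {N : ℕ}

/-- Position `i` is not determined by the other unerased positions when the erased positions are
those with `s j = true`. -/
def Undetermined (C : Submodule F (Fin N → F)) (i : Fin N) (s : Fin N → Bool) : Prop :=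
  ∃ c ∈ C, (∀ j, j ≠ i → s j = false → c j = 0) ∧ c i ≠ 0

open Classical in
/-- The indicator function of the erasure patterns for which `i` is undetermined. -/
noncomputable def undeterminedInd (C : Submodule F (Fin N → F)) (i : Fin N)
    (s : Fin N → Bool) : ℝ :=
  if Undetermined C i s then 1 else 0

/-- The codewords that vanish at all unerased positions. -/
def shortenedCode (C : Submodule F (Fin N → F)) (s : Fin N → Bool) : Submodule F (Fin N → F) where
  carrier := {c | c ∈ C ∧ ∀ j, s j = false → c j = 0}
  add_mem' := fun ha hb => ⟨C.add_mem ha.1 hb.1, fun j hj => by simp [ha.2 j hj, hb.2 j hj]⟩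
  zero_mem' := ⟨C.zero_mem, fun j _ => rfl⟩
  smul_mem' := fun a c hc => ⟨C.smul_mem a hc.1, fun j hj => by simp [hc.2 j hj]⟩

variable {C : Submodule F (Fin N → F)} {i : Fin N}

theorem mem_shortenedCode {s : Fin N → Bool} {c : Fin N → F} :
    c ∈ shortenedCode C s ↔ c ∈ C ∧ ∀ j, s j = false → c j = 0 := Iff.rfl

theorem Undetermined.mono {s t : Fin N → Bool} (h : ∀ j, j ≠ i → s j = true → t j = true)
    (hs : Undetermined C i s) : Undetermined C i t := by
  obtain ⟨c, hc, h1, h2⟩ := hs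
  refine ⟨c, hc, fun j hj ht => h1 j hj ?_, h2⟩
  by_contra hf
  simp [h j hj (by simpa using hf)] at ht

theorem undetermined_congr {s t : Fin N → Bool} (h : ∀ j, j ≠ i → s j = t j) :
    Undetermined C i s ↔ Undetermined C i t :=
  ⟨.mono fun j hj hs => by rw [← h j hj, hs], .mono fun j hj ht => by rw [h j hj, ht]⟩

theorem undeterminedInd_eq_zero_or_one (s : Fin N → Bool) :
    undeterminedInd C i s = 0 ∨ undeterminedInd C i s = 1 := by
  unfold undeterminedInd
  split_ifs <;> simp

theorem undeterminedInd_nonneg (s : Fin N → Bool) : 0 ≤ undeterminedInd C i s := by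
  rcases undeterminedInd_eq_zero_or_one (C := C) (i := i) s with h | h <;> simp [h]

theorem coordDiff_undeterminedInd_nonneg (j : Fin N) (s : Fin N → Bool) :
    0 ≤ coordDiff j (undeterminedInd C i) s := by
  unfold coordDiff
  by_cases h : Undetermined C i (Function.update s j false)
  · have h' : Undetermined C i (Function.update s j true) := h.mono fun k _ hk => by
      rcases eq_or_ne k j with rfl | hkj
      · simp
      · simpa [hkj] using hk
    simp [undeterminedInd, h, h']
  · rw [sub_nonneg]
    refine le_trans (le_of_eq ?_) (undeterminedInd_nonneg _)
    simp [undeterminedInd, h]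

theorem coordDiff_undeterminedInd_self (s : Fin N → Bool) :
    coordDiff i (undeterminedInd C i) s = 0 := by
  have : Undetermined C i (Function.update s i true) ↔
      Undetermined C i (Function.update s i false) :=
    undetermined_congr fun j hj => by simp [hj]
  classical exact sub_eq_zero.2 (if_congr this rfl rfl)

/-- Revealing position i imposes the single linear condition c i = 0, which lowers the dimension by
one exactly when some admissible codeword is nonzero there. With Margulis–Russo this yields the area
theorem. -/
theorem coordDiff_finrank_shortenedCode (s : Fin N → Bool) :
    coordDiff i (fun s => (Module.finrank F (shortenedCode C s) : ℝ)) s =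
      undeterminedInd C i s := by
  unfold coordDiff
  set A := shortenedCode C (Function.update s i true) with hA
  set B := shortenedCode C (Function.update s i false) with hB
  have memA : ∀ c, c ∈ A ↔ c ∈ C ∧ ∀ j, j ≠ i → s j = false → c j = 0 := fun c => by
    rw [hA, mem_shortenedCode]
    refine and_congr_right fun _ => forall_congr' fun j => ?_
    by_cases hj : j = i <;> simp [hj]
  have memB : ∀ c, c ∈ B ↔ c ∈ A ∧ c i = 0 := fun c => by
    rw [hB, mem_shortenedCode, memA, and_assoc]
    refine and_congr_right fun _ => ⟨fun h => ⟨fun j hj hs => h j (by simp [hj, hs]),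
      h i (by simp)⟩, fun h j hj => ?_⟩
    rcases eq_or_ne j i with rfl | hji
    · exact h.2
    · exact h.1 j hji (by simpa [hji] using hj)
  by_cases h : Undetermined C i s
  · obtain ⟨c, hc, h1, h2⟩ := id h
    have hBA : B ≤ A := fun c hc => ((memB c).1 hc).1
    set φ : Module.Dual F A := (LinearMap.proj i : (Fin N → F) →ₗ[F] F).domRestrict A with hφ
    have hφ0 : φ ≠ 0 := fun h0 => h2 (by
      simpa [hφ] using LinearMap.congr_fun h0 ⟨c, (memA c).2 ⟨hc, h1⟩⟩)
    have hker : LinearMap.ker φ = B.comap A.subtype := by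
      ext ⟨a, ha⟩
      simp [hφ, memB, ha]
    have := Module.Dual.finrank_ker_add_one_of_ne_zero hφ0
    rw [hker, (Submodule.comapSubtypeEquivOfLe hBA).finrank_eq] at this
    change (Module.finrank F A : ℝ) - Module.finrank F B = _
    simp [undeterminedInd, h, ← this]
  · have : A = B := by
      ext c
      rw [memB, iff_self_and]
      intro hc
      by_contra h0
      exact h ⟨c, ((memA c).1 hc).1, ((memA c).1 hc).2, h0⟩
    change (Module.finrank F A : ℝ) - Module.finrank F B = _
    rw [this, undeterminedInd, if_neg h, sub_self]

theorem Undetermined.of_comp_perm {π : Equiv.Perm (Fin N)} (hπ : π ∈ permGroup C)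
    {s : Fin N → Bool} (h : Undetermined C i (s ∘ π)) : Undetermined C (π i) s := by
  obtain ⟨c, hc, h1, h2⟩ := h
  refine ⟨c ∘ ⇑π⁻¹, hπ c hc, fun j hj hs => h1 _ (fun h => hj ?_) ?_, by simpa using h2⟩
  · rw [← h]; simp
  · simpa using hs

theorem undetermined_comp_perm {π : Equiv.Perm (Fin N)} (hπ : π ∈ permGroup C)
    {s : Fin N → Bool} : Undetermined C (π i) s ↔ Undetermined C i (s ∘ π) := by
  refine ⟨fun h => ?_, fun h => h.of_comp_perm hπ⟩
  have := Undetermined.of_comp_perm (C := C) (i := π i) (s := s ∘ π) ((permGroup C).inv_mem hπ)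
    (by convert h using 1; ext j; simp)
  simpa using this

theorem undeterminedInd_comp_perm {π : Equiv.Perm (Fin N)} (hπ : π ∈ permGroup C)
    (s : Fin N → Bool) : undeterminedInd C (π i) s = undeterminedInd C i (s ∘ π) :=
  by classical exact if_congr (undetermined_comp_perm hπ) rfl rfl

theorem biasedExp_undeterminedInd_perm {π : Equiv.Perm (Fin N)} (hπ : π ∈ permGroup C) (p : ℝ) :
    biasedExp p (undeterminedInd C (π i)) = biasedExp p (undeterminedInd C i) := by
  rw [← biasedExp_comp_perm π (undeterminedInd C i)]
  congr 1
  ext s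
  exact undeterminedInd_comp_perm hπ s

theorem biasedExp_coordDiff_undeterminedInd_perm {π : Equiv.Perm (Fin N)}
    (hπ : π ∈ permGroup C) (j : Fin N) (p : ℝ) :
    biasedExp p (coordDiff (π j) (undeterminedInd C (π i))) =
      biasedExp p (coordDiff j (undeterminedInd C i)) := by
  rw [← biasedExp_comp_perm π (coordDiff j (undeterminedInd C i))]
  congr 1
  ext s
  simp only [coordDiff, undeterminedInd_comp_perm hπ,
    Function.update_comp_eq_of_injective s π.injective]

end ErasurePatterns

/-! ### From the channel to erasure patterns: the EXIT function and the decoder. -/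

section Channel

variable {F : Type*} {N : ℕ}

/-- The word received when `x` is sent and the positions with `s j = true` are erased. -/
def received (x : Fin N → F) (s : Fin N → Bool) (j : Fin N) : Option F :=
  if s j = true then none else some (x j)

theorem received_injective (x : Fin N → F) : Function.Injective (received x) := by
  intro s t h
  funext j
  have := congr_fun h j
  unfold received at this
  cases hs : s j <;> cases ht : t j <;> simp [hs, ht] at this ⊢

/-- Given `x`, only words obtained by erasing entries of `x` have positive weight, and they
correspond bijectively to erasure patterns. -/
theorem sum_prod_erasureKernel [Fintype F] (p : ℝ) (x : Fin N → F)
    (φ : (Fin N → Option F) → ℝ) :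
    ∑ y : Fin N → Option F, (∏ j, erasureKernel p (x j) (y j)) * φ y =
      biasedExp p (fun s => φ (received x s)) := by
  classical
  unfold biasedExp
  symm
  refine Finset.sum_of_injOn (received x) (received_injective x).injOn (by simp) ?_ ?_
  · intro y _ hy
    suffices h : ∃ j, erasureKernel p (x j) (y j) = 0 by
      obtain ⟨j, hj⟩ := h
      rw [Finset.prod_eq_zero (Finset.mem_univ j) hj, zero_mul]
    by_contra! h
    refine hy ⟨fun j => (y j).isNone, by simp, ?_⟩
    funext j
    have := h j
    cases hyj : y j with
    | none => simp [received, hyj]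
    | some b =>
      rw [hyj] at this
      simp only [erasureKernel, ne_eq, ite_eq_right_iff, not_forall] at this
      simp [received, hyj, this.1]
  · intro s _
    congr 1
    refine Finset.prod_congr rfl fun j _ => ?_
    cases hs : s j <;> simp [received, hs, erasureKernel]

/-- The erasure pattern that can be read off from the received symbols at the positions other
than `i`. -/
def patternOf {i : Fin N} (v : {j : Fin N // j ≠ i} → Option F) (j : Fin N) : Bool :=
  if h : j ≠ i then (v ⟨j, h⟩).isNone else false

theorem patternOf_received {i : Fin N} (x : Fin N → F) (s : Fin N → Bool) {j : Fin N} (hj : j ≠ i) :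
    patternOf (fun j : {j : Fin N // j ≠ i} => received x s j) j = s j := by
  cases hs : s j <;> simp [patternOf, hj, received, hs]

theorem received_add [Field F] {i : Fin N} {x c : Fin N → F} {s : Fin N → Bool} {v : {j : Fin N // j ≠ i} → Option F}
    (hc : ∀ j, j ≠ i → patternOf v j = false → c j = 0)
    (h : (fun j : {j : Fin N // j ≠ i} => received x s j) = v) :
    (fun j : {j : Fin N // j ≠ i} => received (x + c) s j) = v := by
  rw [← h]
  funext ⟨j, hj⟩
  have := hc j hj
  rw [← h, patternOf_received x s hj] at this
  cases hs : s j
  · simp [received, hs, this hs]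
  · simp [received, hs]

theorem symbolMAP_received [Field F] {C : Submodule F (Fin N → F)} {i : Fin N} {x : Fin N → F} (hx : x ∈ C) {s : Fin N → Bool}
    (h : ¬ Undetermined C i s) : symbolMAP C i (received x s) = some (x i) := by
  have hu : ∀ a, (∃ z ∈ C, Compatible z (received x s) ∧ z i = a) → a = x i := by
    rintro a ⟨z, hz, hzc, rfl⟩
    by_contra hne
    refine h ⟨z - x, C.sub_mem hz hx, fun j _ hs => ?_, sub_ne_zero.2 hne⟩
    have := hzc j
    simp only [received, hs] at this
    simp at this
    simp [this]
  have hex : ∃! a : F, ∃ z ∈ C, Compatible z (received x s) ∧ z i = a := by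
    refine ⟨x i, ⟨x, hx, fun j => ?_, rfl⟩, hu⟩
    cases hs : s j <;> simp [received, hs]
  rw [symbolMAP, dif_pos hex]
  exact congr_arg some (hu _ hex.choose_spec.1)

variable [Field F] [Fintype F] {C : Submodule F (Fin N → F)} {i : Fin N} {p : ℝ}

open Classical in
theorem eventProb_eq (E : (Fin N → F) → (Fin N → Option F) → Prop) :
    eventProb C p E = (Nat.card C : ℝ)⁻¹ * ∑ x with x ∈ C,
      biasedExp p (fun s => if E x (received x s) then 1 else 0) := by
  unfold eventProb
  rw [Finset.mul_sum, Finset.sum_filter]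
  refine Finset.sum_congr rfl fun x _ => ?_
  rw [← sum_prod_erasureKernel p x fun y => if E x y then 1 else 0]
  by_cases hx : x ∈ C
  · simp [jointProb, hx, Finset.mul_sum]
  · simp [jointProb, hx]

open Classical in
theorem inv_card_mul_sum_const (a : ℝ) :
    (Nat.card C : ℝ)⁻¹ * ∑ x : Fin N → F with x ∈ C, a = a := by
  have : Finset.card {x : Fin N → F | x ∈ C} = Nat.card C := by
    rw [Nat.card_eq_fintype_card, Fintype.card_subtype]
  have h0 : (Nat.card C : ℝ) ≠ 0 := by
    exact_mod_cast Nat.card_pos.ne'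
  rw [Finset.sum_const, this, nsmul_eq_mul, inv_mul_cancel_left₀ h0]

theorem eventProb_nonneg (h0 : 0 ≤ p) (h1 : p ≤ 1)
    (E : (Fin N → F) → (Fin N → Option F) → Prop) : 0 ≤ eventProb C p E := by
  classical
  rw [eventProb_eq]
  refine mul_nonneg (by positivity) (Finset.sum_nonneg fun x _ =>
    biasedExp_nonneg h0 h1 fun s => ?_)
  split_ifs <;> simp

/-- Translation by a codeword that vanishes on the unerased positions other than i and equals u' - u
at i permutes the code and leaves the observation `v` unchanged. -/
theorem eventProb_eq_of_undetermined {v : {j : Fin N // j ≠ i} → Option F}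
    (h : Undetermined C i (patternOf v)) (u u' : F) :
    eventProb C p (fun x y => x i = u ∧ (fun j : {j : Fin N // j ≠ i} => y j) = v) =
      eventProb C p (fun x y => x i = u' ∧ (fun j : {j : Fin N // j ≠ i} => y j) = v) := by
  classical
  obtain ⟨c, hc, h1, h2⟩ := h
  set d : Fin N → F := ((u' - u) * (c i)⁻¹) • c with hd
  have hdC : d ∈ C := C.smul_mem _ hc
  have hdi : d i = u' - u := by simp [hd, h2]
  have hd0 : ∀ j, j ≠ i → patternOf v j = false → d j = 0 := fun j hj hs => by
    simp [hd, h1 j hj hs]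
  rw [eventProb_eq, eventProb_eq]
  congr 1
  rw [Finset.sum_filter, Finset.sum_filter]
  refine (Finset.sum_congr rfl fun x _ => ?_).trans (Equiv.sum_comp (Equiv.addRight d) _)
  have e1 : x + d ∈ C ↔ x ∈ C := C.add_mem_iff_left hdC
  have e2 : (x + d) i = u' ↔ x i = u := by
    rw [Pi.add_apply, hdi, ← sub_eq_zero, ← sub_eq_zero (a := x i)]
    ring_nf
  have e3 : ∀ s, (fun j : {j : Fin N // j ≠ i} => received (x + d) s j) = v ↔
      (fun j : {j : Fin N // j ≠ i} => received x s j) = v := fun s =>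
    ⟨fun h => by
      simpa using received_add (c := -d) (fun j hj hs => by simp [hd0 j hj hs]) h,
      received_add hd0⟩
  simp only [Equiv.coe_addRight, e1, e2, e3]
  congr!

/-- Two codewords consistent with `v` but different at i would have a difference witnessing that i
is undetermined. -/
theorem eventProb_eq_zero_of_not_undetermined {v : {j : Fin N // j ≠ i} → Option F}
    (h : ¬ Undetermined C i (patternOf v)) {u u' : F} (huu : u ≠ u')
    (hu : eventProb C p (fun x y => x i = u ∧ (fun j : {j : Fin N // j ≠ i} => y j) = v) ≠ 0) :
    eventProb C p (fun x y => x i = u' ∧ (fun j : {j : Fin N // j ≠ i} => y j) = v) = 0 := by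
  classical
  have key : ∀ u, eventProb C p
      (fun x y => x i = u ∧ (fun j : {j : Fin N // j ≠ i} => y j) = v) ≠ 0 →
      ∃ x ∈ C, ∃ s, x i = u ∧ (fun j : {j : Fin N // j ≠ i} => received x s j) = v := by
    intro u hu
    by_contra! hne
    refine hu ?_
    rw [eventProb_eq, Finset.sum_eq_zero, mul_zero]
    intro x hx
    have : ∀ s, ¬ (x i = u ∧ (fun j : {j : Fin N // j ≠ i} => received x s j) = v) :=
      fun s hs => hne x (by simpa using hx) s hs.1 hs.2
    simp [this, biasedExp]
  by_contra hu'
  obtain ⟨x, hx, s, hxu, hxv⟩ := key u hu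
  obtain ⟨x', hx', s', hxu', hxv'⟩ := key u' hu'
  refine h ⟨x - x', C.sub_mem hx hx', fun j hj hp => ?_, by
    rwa [Pi.sub_apply, hxu, hxu', sub_ne_zero]⟩
  have a1 := congr_fun hxv ⟨j, hj⟩
  have a2 := congr_fun hxv' ⟨j, hj⟩
  have b1 : s j = false := by rw [← patternOf_received x s hj, hxv, hp]
  have b2 : s' j = false := by rw [← patternOf_received x' s' hj, hxv', hp]
  rw [← a2] at a1
  simpa [received, b1, b2, sub_eq_zero] using a1

theorem sum_eventProb_symbol (V : (Fin N → Option F) → Prop) :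
    ∑ u, eventProb C p (fun x y => x i = u ∧ V y) = eventProb C p (fun _ y => V y) := by
  classical
  simp only [eventProb_eq]
  rw [← Finset.mul_sum, Finset.sum_comm]
  congr 1
  refine Finset.sum_congr rfl fun x _ => ?_
  rw [← biasedExp_sum]
  congr 1
  ext s
  by_cases h : V (received x s) <;> simp [h]

/-- The posterior is uniform on `F` or a point mass, with base-q entropy 1 or 0. The weight stays on
both sides because the quotients mean nothing when it is zero. -/
theorem eventProb_mul_sum_negMulLog (v : {j : Fin N // j ≠ i} → Option F) :
    eventProb C p (fun _ y => (fun j : {j : Fin N // j ≠ i} => y j) = v) *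
      ∑ u : F, Real.negMulLog
        (eventProb C p (fun x y => x i = u ∧ (fun j : {j : Fin N // j ≠ i} => y j) = v) /
          eventProb C p (fun _ y => (fun j : {j : Fin N // j ≠ i} => y j) = v)) /
          Real.log (Fintype.card F) =
    eventProb C p (fun _ y => (fun j : {j : Fin N // j ≠ i} => y j) = v) *
      undeterminedInd C i (patternOf v) := by
  classical
  have hsum := sum_eventProb_symbol (C := C) (p := p) (i := i)
    (fun y => (fun j : {j : Fin N // j ≠ i} => y j) = v)
  set P := eventProb C p (fun _ y => (fun j : {j : Fin N // j ≠ i} => y j) = v) with hP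
  rcases eq_or_ne P 0 with hP0 | hP0
  · rw [hP0, zero_mul, zero_mul]
  congr 1
  by_cases h : Undetermined C i (patternOf v)
  · have hq : (1 : ℝ) < Fintype.card F := by exact_mod_cast Fintype.one_lt_card
    have hlog := (Real.log_pos hq).ne'
    have hu : ∀ u, eventProb C p
        (fun x y => x i = u ∧ (fun j : {j : Fin N // j ≠ i} => y j) = v) / P =
        (Fintype.card F : ℝ)⁻¹ := by
      intro u
      rw [Finset.sum_congr rfl fun u' _ => eventProb_eq_of_undetermined h u' u] at hsum
      rw [Finset.sum_const, nsmul_eq_mul, Finset.card_univ] at hsum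
      rw [div_eq_iff hP0, ← hsum]
      field_simp
    simp only [hu, undeterminedInd, h, if_true, Real.negMulLog, Real.log_inv, Finset.sum_const,
      Finset.card_univ, nsmul_eq_mul]
    field_simp
  · rw [undeterminedInd, if_neg h]
    refine Finset.sum_eq_zero fun u _ => ?_
    rw [div_eq_zero_iff]
    left
    rcases eq_or_ne (eventProb C p
      (fun x y => x i = u ∧ (fun j : {j : Fin N // j ≠ i} => y j) = v)) 0 with h0 | h0
    · simp [h0]
    · rw [Finset.sum_eq_single u (fun u' _ hu' =>
        eventProb_eq_zero_of_not_undetermined h hu'.symm h0) (by simp)] at hsum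
      rw [hsum, div_self hP0, Real.negMulLog_one]

theorem exitFunction_eq : exitFunction C i p = biasedExp p (undeterminedInd C i) := by
  classical
  have h : ∀ x s, undeterminedInd C i
      (patternOf fun j : {j : Fin N // j ≠ i} => received (F := F) x s j) =
        undeterminedInd C i s := fun x s => by
    simp only [undeterminedInd, undetermined_congr fun j hj => patternOf_received x s hj]
  unfold exitFunction condEntropy
  simp only [eventProb_mul_sum_negMulLog]
  simp only [eventProb_eq, mul_assoc, Finset.sum_mul]
  rw [← Finset.mul_sum, Finset.sum_comm]
  rw [← inv_card_mul_sum_const (C := C) (biasedExp p (undeterminedInd C i))]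
  congr 1
  refine Finset.sum_congr rfl fun x _ => ?_
  simp only [mul_comm (biasedExp p _), ← biasedExp_const_mul]
  rw [← biasedExp_sum]
  congr 1
  ext s
  simp [h]

/-- The decoder succeeds whenever the other positions determine i. It also sees Y_i, so only an
inequality is claimed. -/
theorem symbolErasureProb_le (h0 : 0 ≤ p) (h1 : p ≤ 1) :
    symbolErasureProb C i p ≤ exitFunction C i p := by
  classical
  rw [exitFunction_eq, symbolErasureProb, eventProb_eq,
    ← inv_card_mul_sum_const (C := C) (biasedExp p (undeterminedInd C i))]
  refine mul_le_mul_of_nonneg_left (Finset.sum_le_sum fun x hx =>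
    biasedExp_mono h0 h1 fun s => ?_) (by positivity)
  by_cases h : Undetermined C i s
  · rw [undeterminedInd, if_pos h]
    split_ifs <;> simp
  · rw [undeterminedInd, if_neg h, symbolMAP_received (by simpa using hx) h]
    simp

theorem avgErasureProb_nonneg (h0 : 0 ≤ p) (h1 : p ≤ 1) : 0 ≤ avgErasureProb C p :=
  mul_nonneg (by positivity) (Finset.sum_nonneg fun _ _ => eventProb_nonneg h0 h1 _)

theorem avgErasureProb_le (h0 : 0 ≤ p) (h1 : p ≤ 1) : avgErasureProb C p ≤ avgExitFunction C p :=
  mul_le_mul_of_nonneg_left (Finset.sum_le_sum fun _ _ => symbolErasureProb_le h0 h1)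
    (by positivity)

end Channel

/-! ### Sharp thresholds from equal influences, and the width of the transition. -/

section SharpThreshold

variable {p : ℝ} {n : ℕ}

theorem biasedExp_one (f : (Fin n → Bool) → ℝ) : biasedExp 1 f = f fun _ => true := by
  induction n with
  | zero => rw [biasedExp_zero, Subsingleton.elim default]
  | succ n ih =>
    rw [biasedExp_succ, ih, sub_self, zero_mul, one_mul, add_zero]
    exact congr_arg f (funext fun j => by cases j using Fin.cases <;> simp)

theorem biasedExp_zero_left (f : (Fin n → Bool) → ℝ) : biasedExp 0 f = f fun _ => false := by
  induction n with
  | zero => rw [biasedExp_zero, Subsingleton.elim default]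
  | succ n ih =>
    rw [biasedExp_succ, sub_zero, zero_mul, one_mul, zero_add, ih]
    exact congr_arg f (funext fun j => by cases j using Fin.cases <;> simp)

/-- This is n ≤ (n - 1)²; it converts a bound in terms of the n - 1 equal influences into one in log
n. -/
theorem log_le_two_mul_log_sub_one (hn : 3 ≤ n) :
    Real.log n ≤ 2 * Real.log ((n : ℝ) - 1) := by
  have hn' : (3 : ℝ) ≤ n := by exact_mod_cast hn
  have h := Real.log_pow ((n : ℝ) - 1) 2
  push_cast at h
  rw [← h]
  exact Real.log_le_log (by linarith) (by nlinarith)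

/-- A monotone Boolean function all of whose influences, apart from a vanishing one, are equal has
a sharp threshold, uniformly in the bias. -/
theorem log_mul_variance_le_sum_influence (hn : 3 ≤ n) (h0 : 0 ≤ p) (h1 : p ≤ 1)
    {f : (Fin n → Bool) → ℝ} (hf : ∀ x, f x = 0 ∨ f x = 1) (hmono : ∀ j x, 0 ≤ coordDiff j f x)
    {i : Fin n} (hi : ∀ x, coordDiff i f x = 0)
    (heq : ∀ j k, j ≠ i → k ≠ i →
      biasedExp p (coordDiff j f) = biasedExp p (coordDiff k f)) :
    1 / 80 * Real.log n * (biasedExp p f * (1 - biasedExp p f)) ≤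
      ∑ j, biasedExp p (coordDiff j f) := by
  have hD : ∀ j x, coordDiff j f x = 0 ∨ coordDiff j f x = 1 := fun j x => by
    have := hmono j x
    unfold coordDiff at this ⊢
    rcases hf (Function.update x j true) with h | h <;>
      rcases hf (Function.update x j false) with h' | h' <;> rw [h, h'] at this ⊢ <;>
      first | (norm_num; done) | linarith
  have habs : ∀ j, (fun x => |coordDiff j f x|) = coordDiff j f := fun j => by
    ext x
    rcases hD j x with h | h <;> simp [h]
  have hsq : ∀ j, (fun x => coordDiff j f x ^ 2) = coordDiff j f := fun j => by
    ext x
    rcases hD j x with h | h <;> simp [h]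
  have hfsq : (fun x => f x ^ 2) = f := by
    ext x
    rcases hf x with h | h <;> simp [h]
  have hn' : (3 : ℝ) ≤ n := by exact_mod_cast hn
  have : Nontrivial (Fin n) := Fin.nontrivial_iff_two_le.2 (by omega)
  obtain ⟨k, hk⟩ := exists_ne i
  set I := biasedExp p (coordDiff k f) with hI
  have hI0 : 0 ≤ I := biasedExp_nonneg h0 h1 (hmono k)
  have hIi : biasedExp p (coordDiff i f) = 0 := by simp [biasedExp, hi]
  have hcard : ((Finset.univ.erase i).card : ℝ) = n - 1 := by
    rw [Finset.card_erase_of_mem (Finset.mem_univ i), Finset.card_univ, Fintype.card_fin,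
      Nat.cast_sub (by omega), Nat.cast_one]
  have hsum : ∀ φ : ℝ → ℝ, φ 0 = 0 →
      ∑ j, φ (biasedExp p (coordDiff j f)) = ((n : ℝ) - 1) * φ I := by
    intro φ hφ
    rw [← Finset.add_sum_erase _ _ (Finset.mem_univ i), hIi, hφ, zero_add,
      Finset.sum_congr rfl fun j hj => by rw [heq j k (Finset.ne_of_mem_erase hj) hk],
      Finset.sum_const, nsmul_eq_mul, hcard]
  set M : ℝ := n - 1 with hM
  have hM2 : 2 ≤ M := by linarith
  have hM0 : 0 < M := by linarith
  -- The free parameter t is taken to be √M: its logarithm is still L/2, while the quadratic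
  -- influence term is negligible if the total influence is only logarithmic.
  set s := √M with hs
  have hs0 : 0 < s := Real.sqrt_pos.2 hM0
  have hss : s ^ 2 = M := Real.sq_sqrt hM0.le
  set L := Real.log M with hL
  have hL0 : 0 < L := Real.log_pos (by linarith)
  have key := variance_mul_log_le h0 h1 f hs0
  simp only [habs, hsq, hfsq] at key
  rw [hsum (fun y => (y / 2) ^ 2) (by norm_num), hsum (fun y => y) rfl, hs,
    Real.log_sqrt hM0.le, ← hs, ← hL] at key
  rw [hsum (fun y => y) rfl]
  set h := biasedExp p f
  have hh0 : 0 ≤ h := biasedExp_nonneg h0 h1 fun x => by rcases hf x with h | h <;> simp [h]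
  have hh1 : h ≤ 1 := by
    have := biasedExp_mono h0 h1 (f := f) (g := fun _ => 1) fun x => by
      rcases hf x with h | h <;> simp [h]
    simpa [biasedExp_const] using this
  set v := h * (1 - h) with hv
  have hv0 : 0 ≤ v := mul_nonneg hh0 (sub_nonneg.2 hh1)
  have hv4 : v ≤ 1 / 4 := by nlinarith [sq_nonneg (2 * h - 1)]
  have hvv : h - h ^ 2 = v := by rw [hv]; ring
  rw [hvv] at key
  have hLn := log_le_two_mul_log_sub_one hn
  have hLs : L ≤ 2 * s := by
    have := Real.log_le_sub_one_of_pos hs0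
    rw [hs, Real.log_sqrt hM0.le, ← hs] at this
    linarith
  suffices hgoal : L * v / 40 ≤ M * I by nlinarith
  -- If T = M I were below Lv/40, then T ≤ s and the quadratic term is at most T/4, so (L/2 + 1)v ≤
  -- (9 + 1/4)T < (9.25/40)Lv, which is absurd. The 80 is this 40 doubled by log n ≤ 2L.
  by_contra! hlt
  have hT0 : 0 ≤ M * I := by positivity
  have hv0' : 0 < v := by
    rcases hv0.eq_or_lt with h | h
    · rw [← h] at hlt; linarith
    · exact h
  have e1 : s * (M * (I / 2) ^ 2) = (M * I) * ((M * I) / (4 * s)) := by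
    rw [← hss]; field_simp; ring
  have e2 : (M * I) / (4 * s) ≤ 1 / 4 := by
    rw [div_le_iff₀ (by positivity)]
    nlinarith
  nlinarith

variable {h h' : ℝ → ℝ}

theorem monotoneOn_unitInterval (hd : ∀ p, HasDerivAt h (h' p) p)
    (hnn : ∀ p ∈ Set.Icc (0 : ℝ) 1, 0 ≤ h' p) : MonotoneOn h (Set.Icc 0 1) := by
  refine monotoneOn_of_deriv_nonneg (convex_Icc 0 1)
    (fun x _ => (hd x).continuousAt.continuousWithinAt)
    (fun x _ => (hd x).differentiableAt.differentiableWithinAt) fun x hx => ?_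
  rw [(hd x).deriv]
  exact hnn x (interior_subset hx)

theorem bddBelow_superlevel (t : ℝ) : BddBelow {p : ℝ | p ∈ Set.Icc (0 : ℝ) 1 ∧ t ≤ h p} :=
  ⟨0, fun _ hp => hp.1.1⟩

theorem sInf_superlevel_mem (hcont : Continuous h) (h1 : h 1 = 1) {t : ℝ} (ht : t ≤ 1) :
    sInf {p : ℝ | p ∈ Set.Icc (0 : ℝ) 1 ∧ t ≤ h p} ∈ {p : ℝ | p ∈ Set.Icc (0 : ℝ) 1 ∧ t ≤ h p} :=
  IsClosed.csInf_mem (isClosed_Icc.inter (isClosed_le continuous_const hcont))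
    ⟨1, by simp, by rw [h1]; exact ht⟩ (bddBelow_superlevel t)

theorem apply_sInf_superlevel (hcont : Continuous h) (h0 : h 0 = 0) (h1 : h 1 = 1) {t : ℝ}
    (ht0 : 0 ≤ t) (ht : t ≤ 1) :
    h (sInf {p : ℝ | p ∈ Set.Icc (0 : ℝ) 1 ∧ t ≤ h p}) = t := by
  have ha := sInf_superlevel_mem hcont h1 ht
  set a := sInf {p : ℝ | p ∈ Set.Icc (0 : ℝ) 1 ∧ t ≤ h p} with ha_def
  obtain ⟨b, hb, hbt⟩ := intermediate_value_Icc ha.1.1 hcont.continuousOn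
    (show t ∈ Set.Icc (h 0) (h a) from ⟨by rw [h0]; exact ht0, ha.2⟩)
  have : a ≤ b := csInf_le (bddBelow_superlevel t) ⟨⟨hb.1, hb.2.trans ha.1.2⟩, hbt.ge⟩
  rw [le_antisymm this hb.2, hbt]

/-- The logit log(h/(1 - h)) has slope at least c, and between the two crossing points it rises by
exactly 2 log((1 - ε)/ε). -/
theorem width_le_of_deriv_ge {c : ℝ} (hc : 0 < c) (hd : ∀ p, HasDerivAt h (h' p) p)
    (hnn : ∀ p ∈ Set.Icc (0 : ℝ) 1, 0 ≤ h' p)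
    (hge : ∀ p ∈ Set.Icc (0 : ℝ) 1, c * (h p * (1 - h p)) ≤ h' p) (h0 : h 0 = 0) (h1 : h 1 = 1)
    {ε : ℝ} (hε : 0 < ε) (hε2 : ε ≤ 1 / 2) :
    sInf {p : ℝ | p ∈ Set.Icc (0 : ℝ) 1 ∧ 1 - ε ≤ h p} -
      sInf {p : ℝ | p ∈ Set.Icc (0 : ℝ) 1 ∧ ε ≤ h p} ≤ 2 / c * Real.log ((1 - ε) / ε) := by
  have hcont : Continuous h := continuous_iff_continuousAt.2 fun x => (hd x).continuousAt
  have hmono := monotoneOn_unitInterval hd hnn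
  have ha := (sInf_superlevel_mem hcont h1 (t := ε) (by linarith)).1
  have hb := (sInf_superlevel_mem hcont h1 (t := 1 - ε) (by linarith)).1
  have hha := apply_sInf_superlevel hcont h0 h1 (t := ε) hε.le (by linarith)
  have hhb := apply_sInf_superlevel hcont h0 h1 (t := 1 - ε) (by linarith) (by linarith)
  set a := sInf {p : ℝ | p ∈ Set.Icc (0 : ℝ) 1 ∧ ε ≤ h p}
  set b := sInf {p : ℝ | p ∈ Set.Icc (0 : ℝ) 1 ∧ 1 - ε ≤ h p}
  have hab : a ≤ b := csInf_le (bddBelow_superlevel ε) ⟨hb, by rw [hhb]; linarith⟩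
  have hrange : ∀ x ∈ Set.Icc a b, x ∈ Set.Icc (0 : ℝ) 1 ∧ 0 < h x ∧ 0 < 1 - h x := by
    intro x hx
    have hx01 : x ∈ Set.Icc (0 : ℝ) 1 := ⟨ha.1.trans hx.1, hx.2.trans hb.2⟩
    have := hmono ha hx01 hx.1
    have := hmono hx01 hb hx.2
    exact ⟨hx01, by linarith, by linarith⟩
  have hφ : ∀ x ∈ Set.Icc a b, HasDerivAt (fun x => Real.log (h x) - Real.log (1 - h x))
      (h' x / h x - -h' x / (1 - h x)) x := fun x hx => by
    obtain ⟨-, h2, h3⟩ := hrange x hx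
    exact ((hd x).log h2.ne').sub (((hd x).const_sub 1).log h3.ne')
  have key := (convex_Icc a b).mul_sub_le_image_sub_of_le_deriv
    (f := fun x => Real.log (h x) - Real.log (1 - h x)) (C := c)
    (fun x hx => (hφ x hx).continuousAt.continuousWithinAt)
    (fun x hx => (hφ x (interior_subset hx)).differentiableAt.differentiableWithinAt)
    (fun x hx => by
      obtain ⟨h1, h2, h3⟩ := hrange x (interior_subset hx)
      rw [(hφ x (interior_subset hx)).deriv]
      have : h' x / h x - -h' x / (1 - h x) = h' x / (h x * (1 - h x)) := by
        field_simp; ring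
      rw [this, le_div_iff₀ (by positivity)]
      exact hge x h1) a (Set.left_mem_Icc.2 hab) b (Set.right_mem_Icc.2 hab) hab
  simp only [hha, hhb, sub_sub_cancel] at key
  rw [Real.log_div (by linarith) hε.ne', div_mul_eq_mul_div, le_div_iff₀ hc]
  linarith

end SharpThreshold

/-! ### Codes with doubly transitive groups: nondegeneracy, width, area bound and capacity. -/

section Codes

variable {F : Type*} [Field F] {N : ℕ} {C : Submodule F (Fin N → F)}

/-- Double transitivity is phrased through point stabilizers, so a third position is needed as the
fixed point of a permutation moving i to j. -/
theorem IsDoublyTransitive.exists_apply_eq {G : Subgroup (Equiv.Perm (Fin N))}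
    (hG : IsDoublyTransitive G) (hN : 3 ≤ N) (i j : Fin N) : ∃ π ∈ G, π i = j := by
  rcases eq_or_ne i j with rfl | hij
  · exact ⟨1, G.one_mem, rfl⟩
  · obtain ⟨k, hk⟩ := Finset.exists_mem_notMem_of_card_lt_card (s := {i, j})
      (t := (Finset.univ : Finset (Fin N)))
      (lt_of_le_of_lt Finset.card_le_two (by rw [Finset.card_univ, Fintype.card_fin]; omega))
    simp only [Finset.mem_insert, Finset.mem_singleton, not_or] at hk
    obtain ⟨π, hπ, -, h⟩ := hG k i j hk.2.1 hk.2.2 hij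
    exact ⟨π, hπ, h⟩

/-- Every position is undetermined when all others are erased, and determined when none is. -/
structure IsNondegenerate (C : Submodule F (Fin N → F)) : Prop where
  undetermined_of_erased : ∀ i, Undetermined C i fun _ => true
  determined_of_received : ∀ i, ¬ Undetermined C i fun _ => false

theorem isNondegenerate_of_isProperCode (h : IsProperCode C) (hd : MinDistAtLeast C 2) :
    IsNondegenerate C where
  undetermined_of_erased i := by
    obtain ⟨c, hc, hi⟩ := h i
    exact ⟨c, hc, by simp, hi⟩
  determined_of_received i := by
    classical
    rintro ⟨c, hc, h0, hi⟩
    have h2 := hd c hc 0 C.zero_mem fun h => hi (by simp [h])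
    have h1 : hammingDist c 0 ≤ 1 := by
      unfold hammingDist
      refine Finset.card_le_one.2 fun j hj k hk => ?_
      simp only [Finset.mem_filter, Finset.mem_univ, true_and, Pi.zero_apply] at hj hk
      rw [not_imp_comm.1 (h0 j · rfl) hj, not_imp_comm.1 (h0 k · rfl) hk]
    have : 2 ≤ hammingDist c 0 := by convert h2
    omega

theorem undetermined_const_iff (hG : IsDoublyTransitive (permGroup C)) (hN : 3 ≤ N) (b : Bool)
    (i j : Fin N) : Undetermined C i (fun _ => b) ↔ Undetermined C j fun _ => b := by
  obtain ⟨π, hπ, rfl⟩ := hG.exists_apply_eq hN i j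
  exact (undetermined_comp_perm (s := fun _ => b) hπ).symm

/-- By transitivity a failure at one position is a failure at all: either every codeword is zero, or
every unit vector is a codeword. The rate excludes both. -/
theorem isNondegenerate_of_codeRate (hG : IsDoublyTransitive (permGroup C)) (hN : 3 ≤ N)
    (h0 : 0 < codeRate C) (h1 : codeRate C < 1) : IsNondegenerate C where
  undetermined_of_erased i := by
    by_contra h
    have hC : C = ⊥ := by
      rw [eq_bot_iff]
      intro c hc
      rw [Submodule.mem_bot]
      funext j
      by_contra hj
      exact h ((undetermined_const_iff hG hN true i j).2 ⟨c, hc, by simp, hj⟩)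
    rw [codeRate, hC, finrank_bot] at h0
    simp at h0
  determined_of_received i h := by
    have hC : C = ⊤ := by
      rw [eq_top_iff]
      intro x _
      rw [pi_eq_sum_univ' x]
      refine C.sum_mem fun j _ => C.smul_mem _ ?_
      obtain ⟨c, hc, h0, hj⟩ := (undetermined_const_iff hG hN false i j).1 h
      convert C.smul_mem (c j)⁻¹ hc using 1
      funext k
      rcases eq_or_ne k j with rfl | hk
      · simp [hj]
      · simp [h0 k hk, hk]
    have hN0 : (N : ℝ) ≠ 0 := by positivity
    rw [codeRate, hC, finrank_top, Module.finrank_fin_fun, div_self hN0] at h1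
    exact h1.false

theorem IsAffineInvariant.isDoublyTransitive (h : IsAffineInvariant C) :
    IsDoublyTransitive (permGroup C) := by
  obtain ⟨E, _, _, Θ, hΘ⟩ := h
  intro i j k hij hik hjk
  have h1 : Θ j - Θ i ≠ 0 := sub_ne_zero.2 fun h => hij (Θ.injective h).symm
  have h2 : Θ k - Θ i ≠ 0 := sub_ne_zero.2 fun h => hik (Θ.injective h).symm
  set β := (Θ k - Θ i) / (Θ j - Θ i) with hβ
  have hβ0 : β ≠ 0 := div_ne_zero h2 h1
  -- This is the affine map fixing Θ i and sending Θ j to Θ k.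
  refine ⟨_, hΘ β (Θ i - β * Θ i) hβ0, ?_, ?_⟩
  · simp [affinePerm]
  · have : β * Θ j + (Θ i - β * Θ i) = Θ k := by
      rw [hβ]; field_simp; ring
    simp [affinePerm, this]

theorem sum_influence_nonneg {p : ℝ} (h0 : 0 ≤ p) (h1 : p ≤ 1) :
    0 ≤ 1 / (N : ℝ) * ∑ i, ∑ j, biasedExp p (coordDiff j (undeterminedInd C i)) :=
  mul_nonneg (by positivity) (Finset.sum_nonneg fun _ _ => Finset.sum_nonneg fun j _ =>
    biasedExp_nonneg h0 h1 (coordDiff_undeterminedInd_nonneg j))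

theorem one_div_mul_sum_const (hN : 1 ≤ N) (a : ℝ) : 1 / (N : ℝ) * ∑ _i : Fin N, a = a := by
  have : (N : ℝ) ≠ 0 := by positivity
  simp [this]

theorem eventually_isNondegenerate {N : ℕ → ℕ} {C : ∀ n, Submodule F (Fin (N n) → F)} {r : ℝ}
    (hN : Tendsto N atTop atTop) (hr : Tendsto (fun n => codeRate (C n)) atTop (𝓝 r))
    (h0 : 0 < r) (h1 : r < 1) (hG : ∀ n, IsDoublyTransitive (permGroup (C n))) :
    ∀ᶠ n in atTop, 3 ≤ N n ∧ IsNondegenerate (C n) := by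
  filter_upwards [hN.eventually_ge_atTop 3, hr.eventually (lt_mem_nhds h0),
    hr.eventually (gt_mem_nhds h1)] with n hn hn0 hn1
  exact ⟨hn, isNondegenerate_of_codeRate (hG n) hn hn0 hn1⟩

variable [Fintype F]

theorem avgExitFunction_eq (p : ℝ) :
    avgExitFunction C p = 1 / (N : ℝ) * ∑ i, biasedExp p (undeterminedInd C i) := by
  simp only [avgExitFunction, exitFunction_eq]

theorem hasDerivAt_avgExitFunction (p : ℝ) :
    HasDerivAt (avgExitFunction C)
      (1 / (N : ℝ) * ∑ i, ∑ j, biasedExp p (coordDiff j (undeterminedInd C i))) p := by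
  rw [show avgExitFunction C = _ from funext avgExitFunction_eq]
  exact (HasDerivAt.fun_sum fun i _ => hasDerivAt_biasedExp _ p).const_mul _

theorem monotoneOn_avgExitFunction : MonotoneOn (avgExitFunction C) (Set.Icc 0 1) :=
  monotoneOn_unitInterval hasDerivAt_avgExitFunction fun _ hp => sum_influence_nonneg hp.1 hp.2

theorem continuous_avgExitFunction : Continuous (avgExitFunction C) :=
  continuous_iff_continuousAt.2 fun x => (hasDerivAt_avgExitFunction x).continuousAt

theorem IsNondegenerate.avgExitFunction_zero (hC : IsNondegenerate C) :
    avgExitFunction C 0 = 0 := by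
  simp [avgExitFunction_eq, biasedExp_zero_left, undeterminedInd, hC.determined_of_received]

theorem IsNondegenerate.avgExitFunction_one (hC : IsNondegenerate C) (hN : 1 ≤ N) :
    avgExitFunction C 1 = 1 := by
  simp only [avgExitFunction_eq, biasedExp_one, undeterminedInd, hC.undetermined_of_erased,
    if_true, one_div_mul_sum_const hN]

theorem log_mul_avgExitFunction_le (hC : IsNondegenerate C) (hN : 2 ≤ N)
    (hG : IsDoublyTransitive (permGroup C)) {p : ℝ} (h0 : 0 ≤ p) (h1 : p ≤ 1) :
    1 / 80 * Real.log N * (avgExitFunction C p * (1 - avgExitFunction C p)) ≤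
      1 / (N : ℝ) * ∑ i, ∑ j, biasedExp p (coordDiff j (undeterminedInd C i)) := by
  rw [← one_div_mul_sum_const (N := N) (by omega)
    (1 / 80 * Real.log N * (avgExitFunction C p * (1 - avgExitFunction C p)))]
  refine mul_le_mul_of_nonneg_left (Finset.sum_le_sum fun i _ => ?_) (by positivity)
  rcases hN.eq_or_lt with rfl | hN
  -- For N = 2 double transitivity is vacuous, but nondegeneracy makes the only other position
  -- decide i, so its influence is 1.
  · obtain ⟨k, hk⟩ := exists_ne i
    have hki : ∀ j, j ≠ i → j = k := by omega
    have hone : coordDiff k (undeterminedInd C i) = fun _ => 1 := by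
      ext s
      have e1 : Undetermined C i (Function.update s k true) :=
        (undetermined_congr fun j hj => by simp [hki j hj]).1 (hC.undetermined_of_erased i)
      have e2 : ¬ Undetermined C i (Function.update s k false) := fun h =>
        hC.determined_of_received i ((undetermined_congr fun j hj => by simp [hki j hj]).1 h)
      simp [coordDiff, undeterminedInd, e1, e2]
    have hle := Finset.single_le_sum (f := fun j => biasedExp p (coordDiff j (undeterminedInd C i)))
      (fun j _ => biasedExp_nonneg h0 h1 (coordDiff_undeterminedInd_nonneg j)) (Finset.mem_univ k)
    simp only [hone, biasedExp_const] at hle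
    have hlog : Real.log (2 : ℕ) ≤ 1 := by
      have := Real.log_two_lt_d9
      push_cast
      linarith
    have hlog0 : 0 ≤ Real.log (2 : ℕ) := Real.log_natCast_nonneg 2
    have hh : avgExitFunction C p * (1 - avgExitFunction C p) ≤ 1 := by
      nlinarith [sq_nonneg (2 * avgExitFunction C p - 1)]
    refine le_trans ?_ hle
    generalize Real.log (2 : ℕ) = l at hlog hlog0
    nlinarith [mul_le_mul_of_nonneg_left hh hlog0]
  · have hsame : avgExitFunction C p = biasedExp p (undeterminedInd C i) := by
      rw [avgExitFunction_eq, ← one_div_mul_sum_const (N := N) (by omega)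
        (biasedExp p (undeterminedInd C i))]
      congr 1
      refine Finset.sum_congr rfl fun j _ => ?_
      obtain ⟨π, hπ, rfl⟩ := hG.exists_apply_eq hN i j
      exact biasedExp_undeterminedInd_perm hπ p
    rw [hsame]
    refine log_mul_variance_le_sum_influence hN h0 h1 undeterminedInd_eq_zero_or_one
      coordDiff_undeterminedInd_nonneg coordDiff_undeterminedInd_self fun j k hj hk => ?_
    rcases eq_or_ne j k with rfl | hjk
    · rfl
    obtain ⟨π, hπ, hπi, hπj⟩ := hG i j k hj.symm hk.symm hjk
    have := biasedExp_coordDiff_undeterminedInd_perm (i := i) hπ j p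
    rw [hπi, hπj] at this
    exact this.symm

theorem transitionWidth_le (hC : IsNondegenerate C) (hN : 2 ≤ N)
    (hG : IsDoublyTransitive (permGroup C)) {ε : ℝ} (hε : 0 < ε) (hε2 : ε ≤ 1 / 2) :
    transitionWidth C ε ≤ 160 * (Real.log ((1 - ε) / ε) / Real.log N) := by
  have hlog : 0 < Real.log N := Real.log_pos (by exact_mod_cast hN)
  refine (width_le_of_deriv_ge (c := 1 / 80 * Real.log N) (by positivity)
    hasDerivAt_avgExitFunction (fun _ hp => sum_influence_nonneg hp.1 hp.2)
    (fun _ hp => log_mul_avgExitFunction_le hC hN hG hp.1 hp.2) hC.avgExitFunction_zero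
    (hC.avgExitFunction_one (by omega)) hε hε2).trans_eq ?_
  field_simp
  ring

/-- A consequence of the area theorem for the average EXIT function. -/
theorem mul_one_sub_le_codeRate (hN : 1 ≤ N) {b a : ℝ} (hb : b ∈ Set.Icc (0 : ℝ) 1)
    (ha : a ≤ avgExitFunction C b) : a * (1 - b) ≤ codeRate C := by
  set R : (Fin N → Bool) → ℝ := fun s => Module.finrank F (shortenedCode C s) with hR
  have hN0 : (0 : ℝ) < N := by positivity
  have hd : ∀ p, HasDerivAt (fun p => biasedExp p R) (N * avgExitFunction C p) p := by
    intro p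
    refine (hasDerivAt_biasedExp R p).congr_deriv ?_
    rw [avgExitFunction_eq, ← mul_assoc, mul_one_div_cancel hN0.ne', one_mul]
    exact Finset.sum_congr rfl fun i _ => congr_arg _ (funext coordDiff_finrank_shortenedCode)
  -- By monotonicity h ≥ a on [b, 1], so the expected dimension grows there by at least N a (1 - b);
  -- it ends at dim C and starts nonnegative.
  have key := (convex_Icc b 1).mul_sub_le_image_sub_of_le_deriv (f := fun p => biasedExp p R)
    (C := N * a) (fun x _ => (hd x).continuousAt.continuousWithinAt)
    (fun x _ => (hd x).differentiableAt.differentiableWithinAt)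
    (fun x hx => by
      have hx := interior_subset hx
      rw [(hd x).deriv]
      have := monotoneOn_avgExitFunction (C := C) hb ⟨hb.1.trans hx.1, hx.2⟩ hx.1
      gcongr
      exact ha.trans this) b (Set.left_mem_Icc.2 hb.2) 1 (Set.right_mem_Icc.2 hb.2) hb.2
  have hnn : 0 ≤ biasedExp b R := biasedExp_nonneg hb.1 hb.2 fun s => by simp [hR]
  have hone : biasedExp 1 R = Module.finrank F C := by
    rw [biasedExp_one, hR]
    have : shortenedCode C (fun _ => true) = C := by
      ext c
      simp [mem_shortenedCode]
    beta_reduce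
    rw [this]
  rw [codeRate, le_div_iff₀ hN0]
  simp only [hone] at key
  linarith

/-- Once h reaches ε by p, it reaches 1 - ε by p + w, and the area to the right of that point is
bounded by the rate. -/
theorem le_codeRate_of_le_avgExitFunction (hC : IsNondegenerate C) (hN : 1 ≤ N) {p ε w : ℝ}
    (hp : p ∈ Set.Icc (0 : ℝ) 1) (hε : 0 < ε) (hε2 : ε ≤ 1 / 2) (hw : transitionWidth C ε ≤ w)
    (h : ε ≤ avgExitFunction C p) : (1 - ε) * (1 - (p + w)) ≤ codeRate C := by
  have h1 : exitInverse C ε ≤ p := csInf_le (bddBelow_superlevel ε) ⟨hp, h⟩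
  have h2 := sInf_superlevel_mem (h := avgExitFunction C) continuous_avgExitFunction
    (hC.avgExitFunction_one hN) (t := 1 - ε) (by linarith)
  refine le_trans ?_ (mul_one_sub_le_codeRate hN h2.1 h2.2)
  have : exitInverse C (1 - ε) ≤ p + w := by
    unfold transitionWidth at hw
    linarith
  unfold exitInverse at this
  gcongr
  linarith

theorem isCapacityAchieving_of_isDoublyTransitive {N : ℕ → ℕ}
    {C : ∀ n, Submodule F (Fin (N n) → F)} {r : ℝ}
    (hN : Tendsto N atTop atTop) (hr : Tendsto (fun n => codeRate (C n)) atTop (𝓝 r))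
    (h0 : 0 < r) (h1 : r < 1) (hG : ∀ n, IsDoublyTransitive (permGroup (C n))) :
    IsCapacityAchieving C r := by
  intro p hp0 hp
  have hp1 : p ≤ 1 := by linarith
  rw [Metric.tendsto_atTop']
  intro δ hδ
  set γ := 1 - p - r with hγ
  have hγ0 : 0 < γ := by rw [hγ]; linarith
  obtain ⟨ε, hε, hεδ, hεγ, hε2⟩ : ∃ ε : ℝ, 0 < ε ∧ ε ≤ δ ∧ ε ≤ γ / 4 ∧ ε ≤ 1 / 2 :=
    ⟨min δ (min (γ / 4) (1 / 2)), by positivity, min_le_left _ _,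
      (min_le_right _ _).trans (min_le_left _ _), (min_le_right _ _).trans (min_le_right _ _)⟩
  have hwidth : Tendsto (fun n => 160 * (Real.log ((1 - ε) / ε) / Real.log (N n))) atTop (𝓝 0) := by
    have h := (tendsto_const_nhds (x := Real.log ((1 - ε) / ε))).div_atTop
      (Real.tendsto_log_atTop.comp (tendsto_natCast_atTop_atTop.comp hN))
    simpa using h.const_mul 160
  obtain ⟨n₀, hn₀⟩ := eventually_atTop.1 ((eventually_isNondegenerate hN hr h0 h1 hG).and
    ((hwidth.eventually (gt_mem_nhds (show 0 < γ / 4 by positivity))).and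
      (hr.eventually (gt_mem_nhds (show r < r + γ / 2 by linarith)))))
  refine ⟨n₀, fun n hn => ?_⟩
  obtain ⟨⟨hn3, hC⟩, hw, hrate⟩ := hn₀ n hn.le
  rw [Real.dist_eq, sub_zero, abs_of_nonneg (avgErasureProb_nonneg hp0 hp1)]
  refine lt_of_le_of_lt (avgErasureProb_le hp0 hp1) (lt_of_lt_of_le ?_ hεδ)
  by_contra! hle
  have := le_codeRate_of_le_avgExitFunction hC (by omega) ⟨hp0, hp1⟩ hε hε2
    ((transitionWidth_le hC (by omega) (hG n) hε hε2).trans hw.le) hle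
  -- With ε and the width at most γ/4, the area is at least (1 - γ/4)(r + 3γ/4) ≥ r + γ/2, since r +
  -- γ = 1 - p ≤ 1. This contradicts the rate being below r + γ/2.
  nlinarith

end Codes

/-- Part 1 is the bound on the transition width, with one absolute constant, for every doubly
transitive code that is proper and has minimum distance at least two; parts 2 and 3 are about
sequences of doubly transitive and of affine-invariant codes. The binary erasure channel with
bit-MAP decoding is the case of a field `F` with two elements. -/
theorem mainTheorem1 :
    ∃ K : ℝ, 0 < K ∧ ∀ (F : Type*) [Field F] [Fintype F],
      (∀ (N : ℕ) (C : Submodule F (Fin N → F)), 1 ≤ N → IsProperCode C → MinDistAtLeast C 2 →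
        IsDoublyTransitive (permGroup C) →
        ∀ ε : ℝ, 0 < ε → ε ≤ 1 / 2 →
          transitionWidth C ε ≤ K * (Real.log ((1 - ε) / ε) / Real.log N)) ∧
      (∀ (N : ℕ → ℕ) (C : ∀ n, Submodule F (Fin (N n) → F)) (r : ℝ),
        Tendsto N atTop atTop → Tendsto (fun n => codeRate (C n)) atTop (𝓝 r) →
        0 < r → r < 1 → (∀ n, IsDoublyTransitive (permGroup (C n))) →
        IsCapacityAchieving C r ∧
        ∀ᶠ n in atTop, ∀ ε : ℝ, 0 < ε → ε ≤ 1 / 2 →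
          transitionWidth (C n) ε ≤ K * (Real.log ((1 - ε) / ε) / Real.log (N n))) ∧
      (∀ (N : ℕ → ℕ) (C : ∀ n, Submodule F (Fin (N n) → F)) (r : ℝ),
        Tendsto N atTop atTop → Tendsto (fun n => codeRate (C n)) atTop (𝓝 r) →
        0 < r → r < 1 → (∀ n, IsAffineInvariant (C n)) →
        IsCapacityAchieving C r ∧
        ∀ᶠ n in atTop, ∀ ε : ℝ, 0 < ε → ε ≤ 1 / 2 →
          transitionWidth (C n) ε ≤ K * (Real.log ((1 - ε) / ε) / Real.log (N n))) := by

  have main : ∀ (F : Type _) [Field F] [Fintype F] (N : ℕ → ℕ)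
      (C : ∀ n, Submodule F (Fin (N n) → F)) (r : ℝ),
      Tendsto N atTop atTop → Tendsto (fun n => codeRate (C n)) atTop (𝓝 r) →
      0 < r → r < 1 → (∀ n, IsDoublyTransitive (permGroup (C n))) →
      IsCapacityAchieving C r ∧ ∀ᶠ n in atTop, ∀ ε : ℝ, 0 < ε → ε ≤ 1 / 2 →
        transitionWidth (C n) ε ≤ 160 * (Real.log ((1 - ε) / ε) / Real.log (N n)) := by
    intro F _ _ N C r hN hr h0 h1 hG
    refine ⟨isCapacityAchieving_of_isDoublyTransitive hN hr h0 h1 hG, ?_⟩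
    filter_upwards [eventually_isNondegenerate hN hr h0 h1 hG] with n hn ε hε hε2
    exact transitionWidth_le hn.2 (by omega) (hG n) hε hε2
  refine ⟨160, by norm_num, fun F _ _ => ⟨?_, main F, fun N C r hN hr h0 h1 hA =>
    main F N C r hN hr h0 h1 fun n => (hA n).isDoublyTransitive⟩⟩
  intro N C hN hproper hdist hG ε hε hε2
  have hC := isNondegenerate_of_isProperCode hproper hdist
  refine transitionWidth_le hC ?_ hG hε hε2
  -- At length 1 there are no other positions, so the all-erased and all-received patterns are
  -- equivalent for i and the two nondegeneracy conditions clash.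
  by_contra! hN2
  obtain rfl : N = 1 := by omega
  exact hC.determined_of_received 0 ((undetermined_congr fun j hj =>
    absurd (Subsingleton.elim j 0) hj).1 (hC.undetermined_of_erased 0))
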